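/- Let $\omega=\{0,1,2,\dots\}$, let $\mathfrak p$ be the pseudo-intersection number, i.e. the least cardinality of a family of subsets of $\omega$ all of whose finite subfamilies have infinite intersection, but for which there is no infinite $P\subseteq\omega$ with $P\setminus A$ finite for every member $A$, and let $\mathfrak c=2^{\aleph_0}$. For a Boolean algebra $\mathfrak B$ let $M(\mathfrak B)$ be the space of bounded finitely additive functions $\mu:\mathfrak B\to\mathbb R$, with the norm $\|\mu\|=\sup_{B\in\mathfrak B}\big(|\mu(B)|+|\mu(1_{\mathfrak B}\setminus B)|\big)$ and the topology of pointwise convergence on the elements of $\mathfrak B$ (which on norm bounded sets is the weak* topology of $M(\mathfrak B)$, identified with the space of signed Radon measures on the Stone space of $\mathfrak B$). For an ultrafilter $x$ on $\mathfrak B$ let $\delta_x\in M(\mathfrak B)$ be given by $\delta_x(B)=1$ if $B\in x$ and $\delta_x(B)=0$ otherwise. For $c,\varepsilon>0$, a $(c,\varepsilon)$-fork in $M(\mathfrak B)$ consists of three measures $d\,\delta_{x_i}+\nu_i$, $i=0,1,2$, where $d\in\mathbb R$ satisfies $|d|\ge c$, $x_0,x_1,x_2$ are distinct ultrafilters on $\mathfrak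 B$, $\nu_i\in M(\mathfrak B)$, and $\|\nu_i-\nu_j\|\le\varepsilon$ for all $i,j$. Let $M^{\ell_1}(\mathcal P(\omega))\subseteq M(\mathcal P(\omega))$ consist of the measures $B\mapsto\sum_{n\in B}x(n)$ with $x\in\ell_1$. **Theorem.** Assume $\mathfrak p=\mathfrak c$. There is an almost disjoint family $\mathcal A$ of infinite subsets of $\omega$ (that is, $A\cap B$ is finite for any distinct $A,B\in\mathcal A$) such that the subalgebra $\mathfrak B$ of $\mathcal P(\omega)$ generated by $\mathcal A$ and all finite subsets of $\omega$ has the following property: for every $0<c<1$ and every sequence $(\mu_n)_{n\in\omega}$ in $M^{\ell_1}(\mathcal P(\omega))$ with $\|\mu_n\|\le 1$ and $|\mu_n(\{n\})|\ge c$ for all $n\in\omega$, the closure in $M(\mathfrak B)$ of the set $\{\mu_k|_{\mathfrak B}:k\in\omega\}$ contains a $(c,c/2)$-fork. -/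

import Mathlib

noncomputable section

namespace ForkTheorem

open Cardinal

/-- A family of sets of natural numbers has the strong finite intersection property if all
intersections of finitely many members are infinite. -/
def HasSFIP (F : Set (Set ℕ)) : Prop :=
  ∀ G : Finset (Set ℕ), (G : Set (Set ℕ)) ⊆ F → (⋂₀ (G : Set (Set ℕ))).Infinite

/-- `P` is a pseudo-intersection of `F`: it is infinite and almost contained in each member. -/
def IsPseudoIntersection (P : Set ℕ) (F : Set (Set ℕ)) : Prop :=
  P.Infinite ∧ ∀ A ∈ F, (P \ A).Finite

/-- The pseudo-intersection number `𝔭`: the least cardinality of a family of subsets of `ω` with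
the strong finite intersection property and without an infinite pseudo-intersection. -/
def pseudoIntersectionNumber : Cardinal.{0} :=
  sInf {κ | ∃ F : Set (Set ℕ), #F = κ ∧ HasSFIP F ∧ ¬ ∃ P, IsPseudoIntersection P F}

/-- Almost disjoint families: distinct members have finite intersection. -/
def IsAlmostDisjoint (𝒜 : Set (Set ℕ)) : Prop :=
  ∀ A ∈ 𝒜, ∀ B ∈ 𝒜, A ≠ B → (A ∩ B).Finite

/-- The subalgebra of `P(ω)` generated by `𝒜` and all finite sets. -/
def generatedAlgebra (𝒜 : Set (Set ℕ)) : BooleanSubalgebra (Set ℕ) :=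
  BooleanSubalgebra.closure (𝒜 ∪ {s | s.Finite})

section Charges

variable (𝔅 : Type*) [BooleanAlgebra 𝔅]

/-- `M(𝔅)`: the vector space of signed finitely additive functions on the Boolean algebra `𝔅` that
are bounded (equivalently, of finite variation).  As a subspace of the product `𝔅 → ℝ` it carries
the topology of pointwise convergence on the elements of `𝔅`. -/
def M : Submodule ℝ (𝔅 → ℝ) where
  carrier := {μ | (∀ a b, Disjoint a b → μ (a ⊔ b) = μ a + μ b) ∧ ∃ C : ℝ, ∀ a, |μ a| ≤ C}
  zero_mem' := ⟨by simp, 0, by simp⟩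
  add_mem' := by
    rintro μ ν ⟨hμ, C, hC⟩ ⟨hν, D, hD⟩
    refine ⟨fun a b h => ?_, C + D, fun a => ?_⟩
    · simp only [Pi.add_apply, hμ a b h, hν a b h]; ring
    · exact (abs_add_le _ _).trans (add_le_add (hC a) (hD a))
  smul_mem' := by
    rintro r μ ⟨hμ, C, hC⟩
    refine ⟨fun a b h => ?_, |r| * C, fun a => ?_⟩
    · simp only [Pi.smul_apply, smul_eq_mul, hμ a b h]; ring
    · simp only [Pi.smul_apply, smul_eq_mul, abs_mul]
      exact mul_le_mul_of_nonneg_left (hC a) (abs_nonneg r)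

/-- An ultrafilter on the Boolean algebra `𝔅`, that is, a point of its Stone space `ult(𝔅)`. -/
structure Ult extends Order.PFilter 𝔅 where
  bot_notMem : ⊥ ∉ toPFilter
  mem_or_compl_mem : ∀ a, a ∈ toPFilter ∨ aᶜ ∈ toPFilter

variable {𝔅}

/-- The variation `|μ|(a) = sup {|μ(b)| + |μ(a \ b)| : b ∈ 𝔅, b ≤ a}`. -/
def variation (μ : M 𝔅) (a : 𝔅) : ℝ :=
  ⨆ b : {b : 𝔅 // b ≤ a}, (|μ.1 b.1| + |μ.1 (a \ b.1)|)

/-- The norm `‖μ‖ = |μ|(1)` on `M(𝔅)`. -/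
def variationNorm (μ : M 𝔅) : ℝ := variation μ ⊤

open Classical in
/-- The point mass `δ_x` at `x ∈ ult(𝔅)`, seen as an element of `M(𝔅)`: as `a ∈ 𝔅` stands for the
clopen set of the ultrafilters containing `a`, one has `δ_x(a) = 1` if `a ∈ x`, and `0` if not. -/
def dirac (x : Ult 𝔅) : M 𝔅 where
  val a := if a ∈ x.toPFilter then 1 else 0
  property := by
    refine ⟨fun a b h => ?_, 1, fun a => by dsimp only; split_ifs <;> simp⟩
    by_cases ha : a ∈ x.toPFilter
    · have hb : b ∉ x.toPFilter := fun hb =>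
        x.bot_notMem (h.eq_bot ▸ Order.PFilter.inf_mem ha hb)
      simp [ha, hb, Order.PFilter.mem_of_le (le_sup_left : a ≤ a ⊔ b) ha]
    · have key : a ⊔ b ∈ x.toPFilter ↔ b ∈ x.toPFilter := by
        refine ⟨fun hab => ?_, Order.PFilter.mem_of_le le_sup_right⟩
        have hc := (x.mem_or_compl_mem a).resolve_left ha
        refine Order.PFilter.mem_of_le ?_ (Order.PFilter.inf_mem hab hc)
        rw [inf_sup_right, inf_compl_self, bot_sup_eq]
        exact inf_le_left
      simp [ha, key]

/-- Three measures `d δ_{x i} + ν i`, `i = 0, 1, 2`, form a `(c, ε)`-fork. -/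
def IsFork (c ε : ℝ) (m : Fin 3 → M 𝔅) : Prop :=
  ∃ (d : ℝ) (x : Fin 3 → Ult 𝔅) (ν : Fin 3 → M 𝔅),
    (∀ i, m i = d • dirac (x i) + ν i) ∧ c ≤ |d| ∧ Function.Injective x ∧
      ∀ i j, variationNorm (ν i - ν j) ≤ ε

/-- A set of measures contains a `(c, ε)`-fork. -/
def ContainsFork (c ε : ℝ) (F : Set (M 𝔅)) : Prop :=
  ∃ m : Fin 3 → M 𝔅, (∀ i, m i ∈ F) ∧ IsFork c ε m

end Charges

/-- `M^{ℓ₁}(P(ω))`: the measures `B ↦ ∑_{n ∈ B} x(n)` with `x ∈ ℓ₁`. -/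
def Mell1 : Set (M (Set ℕ)) :=
  {μ | ∃ x : lp (fun _ : ℕ => ℝ) 1, ∀ B : Set ℕ, μ.1 B = ∑' n : B, x n}

/-- The restriction of a measure on `P(ω)` to a subalgebra. -/
def restrict (𝔅 : BooleanSubalgebra (Set ℕ)) (μ : M (Set ℕ)) : M 𝔅 where
  val b := μ.1 (b : Set ℕ)
  property := by
    obtain ⟨h, C, hC⟩ := μ.2
    refine ⟨fun a b hab => h _ _ ?_, C, fun a => hC _⟩
    have := congrArg (Subtype.val : 𝔅 → Set ℕ) hab.eq_bot
    exact disjoint_iff.2 this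

end ForkTheorem

end

/-!
The set `𝒜` is built in `𝔠` stages, one for each sequence `(μ_n)`, all relative to one
nonprincipal ultrafilter `U` on `ω`. A stage produces three disjoint infinite sets `A 0, A 1, A 2`
such that the measures `B ↦ μ_n (B \ {n})` converge along `A 0 ∪ A 1 ∪ A 2` on every generator
`B` of the final algebra, and such that `μ_n {n}` converges to some `d`. Take ultrafilters `V_i`
containing `A i`. Along `V_i` the measures `μ_n` converge to `d δ_{x_i} + ν_i`, where `x_i` is the
trace of `V_i` on the algebra. The `ν_i` agree on the generators, which form a `π`-system up to
finite sets, so they agree on the whole algebra (`IsNull.eq_zero`, `closure_contains_fork`) and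
even a `(c, 0)`-fork results.

Convergence on `ω`, on finite sets and on the fewer than `𝔠` earlier members of `𝒜` comes from
`𝔭 = 𝔠`: a pseudo-intersection of fewer than `𝔠` sets from `U` turns limits along `U` into limits
along an infinite set `Q` (`exists_infinite_tendsto`). For the members of the same stage
and of later ones, a gliding hump argument (`exists_gliding_hump`) gives `n_k ∈ Q` in consecutive
intervals `I_k` such that `μ_{n_k}` is nearly the pointwise limit `λ ∈ ℓ₁` to the left of `I_k`
and nearly zero to the right of it. If `B` meets `I_k` in `n_k` at most, for almost all `k`, then
`μ_{n_k} (B \ {n_k})` tends to `λ(B)` (`tendsto_weight_of_hump`). Later members of `𝒜` behave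
like this because they are chosen almost disjoint from the union `D` of the intervals used.
To leave room for them, `D` has to be outside `U`; this is achieved by using only the even or
only the odd intervals (`exists_serves`).
-/

namespace ForkTheorem

open Filter Topology Set Cardinal

/-! ### Set functions that vanish on the generated algebra -/

/-- The finitely additive set functions on `P(ω)` that vanish on `𝒜`, on the finite sets and
on `ω`. -/
structure IsNull (𝒜 : Set (Set ℕ)) (h : Set ℕ → ℝ) : Prop where
  add : ∀ a b, Disjoint a b → h (a ∪ b) = h a + h b
  finite : ∀ s, s.Finite → h s = 0
  mem : ∀ A ∈ 𝒜, h A = 0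
  univ : h univ = 0

/-- The generators of the algebra are closed under intersections up to finite sets, hence a null
function vanishes on the whole algebra. The property `p B` of a set `B` which passes through
the algebra operations is that `E ↦ h (B ∩ E)` is null for *every* null function `h`: composing two
such operations handles `B ∩ B'`, and subtracting handles complements. -/
theorem IsNull.eq_zero {𝒜 : Set (Set ℕ)} (had : IsAlmostDisjoint 𝒜) {h : Set ℕ → ℝ}
    (hh : IsNull 𝒜 h) {B : Set ℕ} (hB : B ∈ generatedAlgebra 𝒜) : h B = 0 := by
  let p : Set ℕ → Prop := fun B => ∀ h, IsNull 𝒜 h → IsNull 𝒜 fun E => h (B ∩ E)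
  have hadd : ∀ (B : Set ℕ) (h : Set ℕ → ℝ), IsNull 𝒜 h →
      ∀ a b, Disjoint a b → h (B ∩ (a ∪ b)) = h (B ∩ a) + h (B ∩ b) := fun B h hh a b hab => by
    rw [inter_union_distrib_left]
    exact hh.add _ _ (hab.mono inter_subset_right inter_subset_right)
  have hfin : ∀ B : Set ℕ, B.Finite → p B := fun B hB h hh =>
    ⟨hadd B h hh, fun s _ => hh.finite _ (hB.subset inter_subset_left),
      fun A _ => hh.finite _ (hB.subset inter_subset_left),
      hh.finite _ (hB.subset inter_subset_left)⟩
  have hcompl : ∀ B, p B → p Bᶜ := by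
    intro B hB h hh
    have key : ∀ E, h (Bᶜ ∩ E) = h E - h (B ∩ E) := fun E => by
      have hdj : Disjoint (B ∩ E) (Bᶜ ∩ E) :=
        disjoint_compl_right.mono inter_subset_left inter_subset_left
      have := hh.add _ _ hdj
      rw [← union_inter_distrib_right, union_compl_self, univ_inter] at this
      linarith
    refine ⟨hadd _ h hh, fun s hs => ?_, fun A hA => ?_, ?_⟩
    · rw [key, hh.finite s hs, (hB h hh).finite s hs, sub_zero]
    · rw [key, hh.mem A hA, (hB h hh).mem A hA, sub_zero]
    · rw [key, hh.univ, (hB h hh).univ, sub_zero]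
  have hinter : ∀ B B', p B → p B' → p (B ∩ B') := fun B B' hB hB' h hh => by
    simpa only [inter_assoc] using hB' _ (hB h hh)
  have hp : p B := by
    refine BooleanSubalgebra.closure_bot_sup_induction (p := fun B _ => p B) ?_ ?_ ?_ ?_ hB
    · rintro A (hA | hA)
      · refine fun h hh => ⟨hadd A h hh, fun s hs => hh.finite _ (hs.subset inter_subset_right),
          fun A' hA' => ?_, by simpa using hh.mem A hA⟩
        by_cases hAA' : A = A'
        · simpa [← hAA'] using hh.mem A hA
        · exact hh.finite _ (had A hA A' hA' hAA')
      · exact hfin A hA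
    · exact hfin _ finite_empty
    · intro B _ B' _ hB hB'
      have := hcompl _ (hinter _ _ (hcompl _ hB) (hcompl _ hB'))
      rwa [← compl_union, compl_compl] at this
    · exact fun B _ hB => hcompl B hB
  simpa using (hp h hh).univ

/-! ### Limits along ultrafilters and pseudo-intersections -/

theorem exists_tendsto_ultrafilter (V : Ultrafilter ℕ) {φ : ℕ → ℝ} {C : ℝ}
    (hφ : ∀ n, |φ n| ≤ C) : ∃ ℓ, Tendsto φ V (𝓝 ℓ) := by
  obtain ⟨ℓ, -, hℓ⟩ := (isCompact_Icc (a := -C) (b := C)).ultrafilter_le_nhds (V.map φ)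
    (le_principal_iff.2 (Ultrafilter.mem_map.2 (Filter.univ_mem' fun n => abs_le.1 (hφ n))))
  exact ⟨ℓ, hℓ⟩

/-- Fewer than `𝔭` members of a nonprincipal ultrafilter have a pseudo-intersection. -/
theorem exists_isPseudoIntersection (U : Ultrafilter ℕ) (hU : (U : Filter ℕ) ≤ cofinite)
    {𝒢 : Set (Set ℕ)} (hmem : ∀ G ∈ 𝒢, G ∈ U) (hcard : #𝒢 < pseudoIntersectionNumber) :
    ∃ P, IsPseudoIntersection P 𝒢 := by
  by_contra hP
  refine notMem_of_lt_csInf' hcard ⟨𝒢, rfl, fun G hG hfin => ?_, hP⟩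
  have h1 : ⋂₀ (G : Set (Set ℕ)) ∈ (U : Filter ℕ) :=
    (sInter_mem G.finite_toSet).2 fun s hs => hmem s (hG hs)
  have h2 : (⋂₀ (G : Set (Set ℕ)))ᶜ ∈ (U : Filter ℕ) := hU hfin.compl_mem_cofinite
  exact Ultrafilter.compl_notMem_iff.2 h1 h2

/-- Under `𝔭 = 𝔠`, fewer than `𝔠` bounded sequences converge along a common infinite set, which may
be chosen almost disjoint from fewer than `𝔠` prescribed sets lying outside an ultrafilter. -/
theorem exists_infinite_tendsto (hpc : pseudoIntersectionNumber = continuum)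
    (U : Ultrafilter ℕ) (hU : (U : Filter ℕ) ≤ cofinite)
    {S : Set (ℕ → ℝ)} (hS : ∀ φ ∈ S, ∃ C, ∀ n, |φ n| ≤ C) (hScard : #S < continuum)
    {𝒟 : Set (Set ℕ)} (h𝒟 : ∀ D ∈ 𝒟, D ∉ U) (h𝒟card : #𝒟 < continuum) :
    ∃ Q : Set ℕ, Q.Infinite ∧ (∀ D ∈ 𝒟, (Q ∩ D).Finite) ∧
      ∀ φ ∈ S, ∃ ℓ, Tendsto φ (cofinite ⊓ 𝓟 Q) (𝓝 ℓ) := by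
  have hlim : ∀ φ : S, ∃ ℓ, Tendsto φ.1 U (𝓝 ℓ) := fun φ =>
    (hS φ φ.2).elim fun C hC => exists_tendsto_ultrafilter U hC
  choose ℓ hℓ using hlim
  let G : S × ℕ → Set ℕ := fun q => {n | |q.1.1 n - ℓ q.1| < 1 / ((q.2 : ℝ) + 1)}
  have hG : ∀ q, G q ∈ U := fun q =>
    (Metric.tendsto_nhds.1 (hℓ q.1) _ Nat.one_div_pos_of_nat :)
  obtain ⟨Q, hQ, hQG⟩ := exists_isPseudoIntersection U hU
    (𝒢 := range G ∪ compl '' 𝒟) (by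
      rintro _ (⟨q, rfl⟩ | ⟨D, hD, rfl⟩)
      · exact hG q
      · exact Ultrafilter.compl_mem_iff_notMem.2 (h𝒟 D hD)) (by
      rw [hpc]
      refine (mk_union_le _ _).trans_lt (add_lt_of_lt aleph0_le_continuum ?_
        (mk_image_le.trans_lt h𝒟card))
      refine mk_range_le.trans_lt ?_
      rw [mk_prod, lift_id, lift_id, mk_nat]
      exact mul_lt_of_lt aleph0_le_continuum hScard aleph0_lt_continuum)
  refine ⟨Q, hQ, fun D hD => ?_, fun φ hφ => ⟨ℓ ⟨φ, hφ⟩, ?_⟩⟩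
  · simpa [sdiff_eq] using hQG Dᶜ (Or.inr ⟨D, hD, rfl⟩)
  · refine Metric.tendsto_nhds.2 fun ε hε => ?_
    obtain ⟨k, hk⟩ := exists_nat_one_div_lt hε
    have hfin := (hQG _ (Or.inl ⟨(⟨φ, hφ⟩, k), rfl⟩)).compl_mem_cofinite
    filter_upwards [inter_mem_inf hfin (mem_principal_self Q)] with n hn
    have : n ∈ G (⟨φ, hφ⟩, k) := by
      by_contra h
      exact hn.1 ⟨hn.2, h⟩
    exact lt_trans this hk

/-! ### Gliding humps -/

/-- The measure on `P(ω)` given by a sequence of weights. -/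
noncomputable def weight (x : ℕ → ℝ) (B : Set ℕ) : ℝ := ∑' n : B, x n

theorem weight_eq (x : ℕ → ℝ) (B : Set ℕ) : weight x B = ∑' n, B.indicator x n :=
  tsum_subtype B x

theorem weight_singleton (x : ℕ → ℝ) (n : ℕ) : weight x {n} = x n :=
  tsum_singleton n x

theorem abs_weight_le {x : ℕ → ℝ} (hx : Summable x) (B : Set ℕ) :
    |weight x B| ≤ ∑' n, |x n| := by
  rw [weight_eq]
  refine (norm_tsum_le_tsum_norm (hx.indicator B).norm).trans
    ((hx.indicator B).norm.tsum_le_tsum (fun n => norm_indicator_le_norm_self x n) hx.norm)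

theorem tendsto_weight_Ici {x : ℕ → ℝ} (hx : Summable x) :
    Tendsto (fun N : ℕ => weight (fun m => |x m|) (Ici N)) atTop (𝓝 0) := by
  simp only [weight_eq]
  rw [← tsum_zero (α := ℝ) (β := ℕ) (L := .unconditional _)]
  refine tendsto_tsum_of_dominated_convergence hx.abs (fun m => ?_)
    (Eventually.of_forall fun N m => ?_)
  · refine tendsto_const_nhds.congr' ?_
    filter_upwards [eventually_gt_atTop m] with N hN
    rw [indicator_of_notMem (by simpa using hN)]
  · exact (norm_indicator_le_norm_self _ _).trans (by simp)

theorem tendsto_weight_Iio {F : Filter ℕ} {x : ℕ → ℕ → ℝ} {l : ℕ → ℝ}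
    (h : ∀ m, Tendsto (fun n => x n m) F (𝓝 (l m))) (N : ℕ) :
    Tendsto (fun n => weight (fun m => |x n m - l m|) (Iio N)) F (𝓝 0) := by
  have key : ∀ n, weight (fun m => |x n m - l m|) (Iio N)
      = ∑ m ∈ Finset.range N, |x n m - l m| := fun n => by
    rw [weight, ← Finset.coe_range]
    exact Finset.tsum_subtype' (Finset.range N) fun m => |x n m - l m|
  simp only [key]
  rw [← Finset.sum_const_zero (s := Finset.range N)]
  refine tendsto_finsetSum _ fun m _ => ?_
  simpa using ((h m).sub_const (l m)).abs

/-- Pointwise limits of uniformly bounded elements of `ℓ₁` are in `ℓ₁`. -/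
theorem summable_of_tendsto {F : Filter ℕ} [F.NeBot] {x : ℕ → ℕ → ℝ} {l : ℕ → ℝ} {C : ℝ}
    (hx : ∀ n, Summable (x n)) (hC : ∀ n, ∑' m, |x n m| ≤ C)
    (h : ∀ m, Tendsto (fun n => x n m) F (𝓝 (l m))) : Summable l := by
  refine Summable.of_abs (summable_of_sum_le (c := C) (fun m => abs_nonneg _) fun s => ?_)
  refine le_of_tendsto (tendsto_finsetSum s fun m _ => (h m).abs)
    (Eventually.of_forall fun n => ?_)
  exact ((hx n).abs.sum_le_tsum s fun _ _ => abs_nonneg _).trans (hC n)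

/-- The three errors when the measure with weights `y`, concentrated near `[N, N')`, is compared
with the measure with weights `l` on a set `B` that meets `[N, N')` in `{n}` at most. -/
theorem abs_weight_sub_le {y l : ℕ → ℝ} (hy : Summable y) (hl : Summable l) {N N' n : ℕ}
    (hn : N ≤ n) {B : Set ℕ} (hB : ∀ m ∈ B, N ≤ m → m < N' → m = n) :
    |weight y (B \ {n}) - weight l B| ≤ weight (fun m => |y m - l m|) (Iio N)
      + weight (fun m => |y m|) (Ici N') + weight (fun m => |l m|) (Ici N) := by
  simp only [weight_eq]
  have h1 := ((hy.sub hl).abs).indicator (Iio N)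
  have h2 := hy.abs.indicator (Ici N')
  have h3 := hl.abs.indicator (Ici N)
  rw [← (hy.indicator _).tsum_sub (hl.indicator _), ← h1.tsum_add h2, ← (h1.add h2).tsum_add h3]
  have hd := (hy.indicator (B \ {n})).sub (hl.indicator B)
  refine (norm_tsum_le_tsum_norm hd.norm).trans (hd.norm.tsum_le_tsum (fun m => ?_)
    ((h1.add h2).add h3))
  rw [Real.norm_eq_abs]
  rcases lt_or_ge m N with hmN | hmN
  · have hmn : m ≠ n := by omega
    by_cases hm : m ∈ B
    · have hm' : m ∈ B \ {n} := ⟨hm, hmn⟩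
      simp only [indicator_of_mem hm, indicator_of_mem hm', indicator_of_mem (mem_Iio.2 hmN)]
      have e2 := indicator_nonneg (s := Ici N') (fun m _ => abs_nonneg (y m)) m
      have e3 := indicator_nonneg (s := Ici N) (fun m _ => abs_nonneg (l m)) m
      linarith
    · have hm' : m ∉ B \ {n} := fun h => hm h.1
      simp only [indicator_of_notMem hm, indicator_of_notMem hm', sub_zero, abs_zero]
      have e1 := indicator_nonneg (s := Iio N) (fun m _ => abs_nonneg (y m - l m)) m
      have e2 := indicator_nonneg (s := Ici N') (fun m _ => abs_nonneg (y m)) m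
      have e3 := indicator_nonneg (s := Ici N) (fun m _ => abs_nonneg (l m)) m
      linarith
  · have e1 : |B.indicator l m| ≤ (Ici N).indicator (fun m => |l m|) m := by
      rw [indicator_of_mem (mem_Ici.2 hmN)]
      exact norm_indicator_le_norm_self l m
    have e2 : |(B \ {n}).indicator y m| ≤ (Ici N').indicator (fun m => |y m|) m := by
      by_cases hm : m ∈ B \ {n}
      · have : N' ≤ m := not_lt.1 fun h => hm.2 (hB m hm.1 hmN h)
        rw [indicator_of_mem hm, indicator_of_mem (mem_Ici.2 this)]
      · rw [indicator_of_notMem hm, abs_zero]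
        exact indicator_nonneg (fun m _ => abs_nonneg (y m)) m
    have e3 := indicator_nonneg (s := Iio N) (fun m _ => abs_nonneg (y m - l m)) m
    have e4 := abs_sub ((B \ {n}).indicator y m) (B.indicator l m)
    linarith

/-- A gliding hump: consecutive intervals `[N k, N (k + 1))` and points `n k` in them such that the
weights `x (n k)` are almost equal to `l` on `[0, N k)` and almost zero on `[N (k + 1), ∞)`. -/
theorem exists_gliding_hump {Q : Set ℕ} (hQ : Q.Infinite) {x : ℕ → ℕ → ℝ} {l : ℕ → ℝ}
    (hx : ∀ n, Summable (x n))
    (h : ∀ m, Tendsto (fun n => x n m) (cofinite ⊓ 𝓟 Q) (𝓝 (l m))) :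
    ∃ N n : ℕ → ℕ, StrictMono N ∧ (∀ k, n k ∈ Q ∧ N k ≤ n k ∧ n k < N (k + 1)) ∧
      Tendsto (fun k => weight (fun m => |x (n k) m - l m|) (Iio (N k))) atTop (𝓝 0) ∧
      Tendsto (fun k => weight (fun m => |x (n k) m|) (Ici (N (k + 1)))) atTop (𝓝 0) := by
  have : (cofinite ⊓ 𝓟 Q).NeBot := cofinite_inf_principal_neBot_iff.2 hQ
  have hstep : ∀ N : ℕ, ∃ n N', (n ∈ Q ∧ N ≤ n ∧ n < N') ∧
      weight (fun m => |x n m - l m|) (Iio N) < 1 / ((N : ℝ) + 1) ∧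
      weight (fun m => |x n m|) (Ici N') < 1 / ((N : ℝ) + 1) := by
    intro N
    have hpos : (0 : ℝ) < 1 / ((N : ℝ) + 1) := Nat.one_div_pos_of_nat
    have hev : ∀ᶠ n in cofinite ⊓ 𝓟 Q, n ∈ Q ∧ N ≤ n :=
      ((eventually_principal.2 fun _ h => h).filter_mono inf_le_right).and
        (((eventually_ge_atTop N).filter_mono Nat.cofinite_eq_atTop.le).filter_mono inf_le_left)
    obtain ⟨n, ⟨hnQ, hNn⟩, hn⟩ :=
      (hev.and ((tendsto_weight_Iio h N).eventually_lt_const hpos)).exists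
    obtain ⟨N', hN', hnN'⟩ := (((tendsto_weight_Ici (hx n)).eventually_lt_const hpos).and
      (eventually_gt_atTop n)).exists
    exact ⟨n, N', ⟨hnQ, hNn, hnN'⟩, hn, hN'⟩
  choose n N' h1 h2 h3 using hstep
  let N : ℕ → ℕ := fun k => N'^[k] 0
  have hN : ∀ k, N (k + 1) = N' (N k) := fun k => Function.iterate_succ_apply' N' k 0
  have hmono : StrictMono N := strictMono_nat_of_lt_succ fun k => by
    rw [hN]
    exact (h1 (N k)).2.1.trans_lt (h1 (N k)).2.2
  have hzero : Tendsto (fun k => 1 / ((N k : ℝ) + 1)) atTop (𝓝 0) :=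
    tendsto_one_div_add_atTop_nhds_zero_nat.comp hmono.tendsto_atTop
  have hnn : ∀ (y : ℕ → ℝ) (B : Set ℕ), 0 ≤ weight (fun m => |y m|) B := fun y B =>
    tsum_nonneg fun _ => abs_nonneg _
  refine ⟨N, fun k => n (N k), hmono, fun k => hN k ▸ h1 (N k), ?_, ?_⟩
  · exact squeeze_zero (fun k => hnn _ _) (fun k => (h2 (N k)).le) hzero
  · exact squeeze_zero (fun k => hnn _ _) (fun k => hN k ▸ (h3 (N k)).le) hzero

/-! ### The inductive construction of the almost disjoint family -/

/-- The outcome of one stage of the construction: three disjoint infinite sets `A i` inside a set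
`D`, which the later stages avoid and which has to be outside `U` for them to be able to do so. -/
structure Stage (U : Ultrafilter ℕ) where
  A : Fin 3 → Set ℕ
  D : Set ℕ
  infinite : ∀ i, (A i).Infinite
  subset : ∀ i, A i ⊆ D
  disjoint : ∀ i j, i ≠ j → Disjoint (A i) (A j)
  notMem : D ∉ U

/-- The matrices whose rows are uniformly bounded elements of `ℓ₁`. -/
def BoundedRows : Type :=
  {x : ℕ → ℕ → ℝ // ∃ C, ∀ n, Summable (x n) ∧ ∑' m, |x n m| ≤ C}

/-- The stage `t` serves the matrix `x` and the family of earlier stages `f`: its sets are almost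
disjoint from those of `f`, and the measures `B ↦ μ_n (B \ {n})`, where `μ_n` has the weights `x n`,
converge along the union of the `A i` on all generators of the algebra, namely on the earlier ones,
on the finite sets, on `ω`, on the `A i` themselves, and on the sets almost disjoint from `D`, among
which are the generators that come later. -/
structure Serves {U : Ultrafilter ℕ} (x : BoundedRows) {ι : Type} (f : ι → Stage U)
    (t : Stage U) : Prop where
  finite_inter : ∀ y i, (t.A i ∩ (f y).D).Finite
  tendsto_diag : ∃ d, Tendsto (fun n => x.1 n n) (cofinite ⊓ 𝓟 (⋃ i, t.A i)) (𝓝 d)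
  tendsto : ∀ B : Set ℕ, B.Finite ∨ B = Set.univ ∨ (∃ y i, B = (f y).A i) ∨ (∃ i, B = t.A i) ∨
    (B ∩ t.D).Finite →
    ∃ ℓ, Tendsto (fun n => weight (x.1 n) (B \ {n})) (cofinite ⊓ 𝓟 (⋃ i, t.A i)) (𝓝 ℓ)

/-- Along the points `n k`, `k ∈ K`, of a gliding hump, the measures `B ↦ μ_n (B \ {n})`, where `μ_n`
has the weights `x n`, converge to the measure with weights `l` on the sets `B` that meet the
blocks belonging to `K` in finitely many points besides these `n k`. -/
theorem tendsto_weight_of_hump {N n : ℕ → ℕ} (hN : StrictMono N)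
    (hn : ∀ k, N k ≤ n k ∧ n k < N (k + 1)) {x : ℕ → ℕ → ℝ} {l : ℕ → ℝ}
    (hx : ∀ n, Summable (x n)) (hl : Summable l)
    (h1 : Tendsto (fun k => weight (fun m => |x (n k) m - l m|) (Iio (N k))) atTop (𝓝 0))
    (h2 : Tendsto (fun k => weight (fun m => |x (n k) m|) (Ici (N (k + 1)))) atTop (𝓝 0))
    {K : Set ℕ} {B : Set ℕ}
    (hB : ((B ∩ ⋃ k ∈ K, Ico (N k) (N (k + 1))) \ n '' K).Finite) :
    Tendsto (fun n => weight (x n) (B \ {n})) (cofinite ⊓ 𝓟 (n '' K)) (𝓝 (weight l B)) := by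
  have hninj : StrictMono n := strictMono_nat_of_lt_succ fun k => (hn k).2.trans_le (hn (k + 1)).1
  have hblock : ∀ {k k' m}, N k ≤ m → m < N (k + 1) → N k' ≤ m → m < N (k' + 1) → k = k' := by
    intro k k' m a b a' b'
    have := hN.lt_iff_lt.1 (a.trans_lt b')
    have := hN.lt_iff_lt.1 (a'.trans_lt b)
    omega
  have hsum : Tendsto (fun k => weight (fun m => |x (n k) m - l m|) (Iio (N k))
      + weight (fun m => |x (n k) m|) (Ici (N (k + 1))) + weight (fun m => |l m|) (Ici (N k)))
      atTop (𝓝 0) := by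
    simpa using (h1.add h2).add ((tendsto_weight_Ici hl).comp hN.tendsto_atTop)
  have hev : ∀ᶠ k in atTop, ∀ m ∈ (B ∩ ⋃ k ∈ K, Ico (N k) (N (k + 1))) \ n '' K, m < N k := by
    obtain ⟨b, hb⟩ := hB.bddAbove
    filter_upwards [eventually_gt_atTop b] with k hk m hm
    exact (hb hm).trans_lt (hk.trans_le (hN.le_apply))
  have hlim : Tendsto (fun k => weight (x (n k)) (B \ {n k})) (atTop ⊓ 𝓟 K)
      (𝓝 (weight l B)) := by
    rw [tendsto_iff_dist_tendsto_zero]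
    refine squeeze_zero' (Eventually.of_forall fun _ => dist_nonneg) ?_ (hsum.mono_left inf_le_left)
    filter_upwards [inter_mem_inf hev (mem_principal_self K)] with k hk
    refine abs_weight_sub_le (hx _) hl (hn k).1 fun m hm hNm hmN => ?_
    by_contra hne
    refine (hk.1 m ⟨⟨hm, mem_biUnion hk.2 ⟨hNm, hmN⟩⟩, ?_⟩).not_ge hNm
    rintro ⟨k', -, rfl⟩
    exact hne (congrArg n (hblock (hn k').1 (hn k').2 hNm hmN))
  refine (tendsto_map'_iff.2 hlim).mono_left ?_
  rw [← Nat.cofinite_eq_atTop]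
  intro s hs
  rw [mem_map, mem_inf_principal, mem_cofinite] at hs
  rw [mem_inf_principal, mem_cofinite]
  refine (hs.image n).subset ?_
  rintro _ hm
  simp only [mem_compl_iff, mem_ofPred_eq, Classical.not_imp] at hm
  obtain ⟨⟨k, hk, rfl⟩, hs'⟩ := hm
  exact ⟨k, fun h => hs' (h hk), rfl⟩

/-- One stage of the construction: pseudo-intersections take care of the earlier generators, a
gliding hump inside the resulting set takes care of the present and the later ones. -/
theorem exists_serves (hpc : pseudoIntersectionNumber = continuum)
    (U : Ultrafilter ℕ) (hU : (U : Filter ℕ) ≤ cofinite) (x : BoundedRows) {ι : Type}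
    (hι : #ι < continuum) (f : ι → Stage U) : ∃ t : Stage U, Serves x f t := by
  obtain ⟨x, C, hxC⟩ := x
  have hx := fun n => (hxC n).1
  have hentry : ∀ n m, |x n m| ≤ C := fun n m =>
    ((hx n).abs.le_tsum m fun _ _ => abs_nonneg _).trans (hxC n).2
  have hfin3 : #(Fin 3) < continuum := (mk_lt_aleph0).trans aleph0_lt_continuum
  let φ : (Set ℕ) → ℕ → ℝ := fun B n => weight (x n) (B \ {n})
  -- the sequences that have to converge before the gliding hump is chosen
  let S : Set (ℕ → ℝ) := (range fun m n => x n m) ∪ {fun n => x n n} ∪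
    (range fun s : Finset ℕ => φ s) ∪ {φ Set.univ} ∪ (range fun q : ι × Fin 3 => φ ((f q.1).A q.2))
  obtain ⟨Q, hQ, hQD, hQS⟩ := exists_infinite_tendsto hpc U hU (S := S)
    (𝒟 := range fun y => (f y).D) (by
      have hφ : ∀ B n, |φ B n| ≤ C := fun B n => (abs_weight_le (hx n) _).trans (hxC n).2
      rintro _ ((((⟨m, rfl⟩ | rfl) | ⟨s, rfl⟩) | rfl) | ⟨q, rfl⟩)
      · exact ⟨C, fun n => hentry n m⟩
      · exact ⟨C, fun n => hentry n n⟩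
      · exact ⟨C, hφ _⟩
      · exact ⟨C, hφ _⟩
      · exact ⟨C, hφ _⟩) (by
      have hcount : ∀ {T : Set (ℕ → ℝ)}, T.Countable → #T < continuum := fun hT =>
        (le_aleph0_iff_set_countable.2 hT).trans_lt aleph0_lt_continuum
      refine (mk_union_le _ _).trans_lt (add_lt_of_lt aleph0_le_continuum (hcount ?_)
        (mk_range_le.trans_lt ?_))
      · exact (((countable_range _).union (countable_singleton _)).union
          (countable_range _)).union (countable_singleton _)
      · rw [mk_prod, lift_id, lift_id]
        exact mul_lt_of_lt aleph0_le_continuum hι hfin3)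
    (by rintro _ ⟨y, rfl⟩; exact (f y).notMem) (mk_range_le.trans_lt hι)
  have := cofinite_inf_principal_neBot_iff.2 hQ
  have hl : ∀ m, ∃ ℓ, Tendsto (fun n => x n m) (cofinite ⊓ 𝓟 Q) (𝓝 ℓ) := fun m =>
    hQS _ (Or.inl (Or.inl (Or.inl (Or.inl ⟨m, rfl⟩))))
  choose l hl using hl
  have hlsum : Summable l := summable_of_tendsto hx (fun n => (hxC n).2) hl
  obtain ⟨N, n, hN, hn, h1, h2⟩ := exists_gliding_hump hQ hx hl
  have hnmono : StrictMono n :=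
    strictMono_nat_of_lt_succ fun k => (hn k).2.2.trans_le (hn (k + 1)).2.1
  let D : ℕ → Set ℕ := fun e => ⋃ k ∈ {k | k % 2 = e}, Ico (N k) (N (k + 1))
  -- The even blocks are disjoint from the odd ones, so one of the two unions is not in `U`.
  obtain ⟨e, he, heU⟩ : ∃ e, e < 2 ∧ D e ∉ U := by
    by_contra! h
    have h01 := U.inter_mem (h 0 (by norm_num)) (h 1 (by norm_num))
    obtain ⟨m, hm0, hm1⟩ := U.nonempty_of_mem h01
    simp only [D, mem_iUnion₂, mem_ofPred_eq, mem_Ico] at hm0 hm1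
    obtain ⟨k, hk, hkm⟩ := hm0
    obtain ⟨k', hk', hkm'⟩ := hm1
    have := hN.lt_iff_lt.1 (hkm.1.trans_lt hkm'.2)
    have := hN.lt_iff_lt.1 (hkm'.1.trans_lt hkm.2)
    omega
  -- The residues `e`, `2 + e`, `4 + e` modulo `6` split the indices of parity `e` in three.
  let A : Fin 3 → Set ℕ := fun i => n '' {k | k % 6 = 2 * i + e}
  have hAQ : ∀ i, A i ⊆ Q := by
    rintro i _ ⟨k, -, rfl⟩
    exact (hn k).1
  have hAK : ∀ i, A i ⊆ n '' {k | k % 2 = e} := fun i => image_mono fun k hk => by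
    simp only [mem_ofPred_eq] at hk ⊢
    omega
  let t : Stage U :=
    { A := A
      D := D e
      infinite := fun i => by
        refine Infinite.image hnmono.injective.injOn
          (infinite_of_injective_forall_mem (f := fun j => 6 * j + (2 * i + e))
            (fun a b hab => by simpa using hab) fun j => ?_)
        simp only [mem_ofPred_eq]
        omega
      subset := by
        rintro i m hm
        obtain ⟨k, hk, rfl⟩ := hAK i hm
        exact mem_biUnion hk (hn k).2
      disjoint := fun i j hij => by
        refine (disjoint_image_iff hnmono.injective).2 (disjoint_left.2 fun k hi hj => hij ?_)
        simp only [mem_ofPred_eq] at hi hj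
        omega
      notMem := heU }
  have hAleQ : cofinite ⊓ 𝓟 (⋃ i, t.A i) ≤ cofinite ⊓ 𝓟 Q :=
    inf_le_inf_left _ (principal_mono.2 (iUnion_subset hAQ))
  have hAleK : cofinite ⊓ 𝓟 (⋃ i, t.A i) ≤ cofinite ⊓ 𝓟 (n '' {k | k % 2 = e}) :=
    inf_le_inf_left _ (principal_mono.2 (iUnion_subset hAK))
  have hS : ∀ φ ∈ S, ∃ ℓ, Tendsto φ (cofinite ⊓ 𝓟 (⋃ i, t.A i)) (𝓝 ℓ) := fun φ hφ =>
    (hQS φ hφ).imp fun ℓ h => h.mono_left hAleQ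
  refine ⟨t, fun y i => (hQD _ ⟨y, rfl⟩).subset (inter_subset_inter_left _ (hAQ i)),
    hS _ (Or.inl (Or.inl (Or.inl (Or.inr rfl)))), ?_⟩
  have hhump := fun {B} hB => (tendsto_weight_of_hump hN (fun k => (hn k).2) hx hlsum h1 h2
    (K := {k | k % 2 = e}) (B := B) hB).mono_left hAleK
  rintro B (hB | rfl | ⟨y, i, rfl⟩ | ⟨i, rfl⟩ | hB)
  · exact hS _ (Or.inl (Or.inl (Or.inr ⟨hB.toFinset, by simp [φ]⟩)))
  · exact hS _ (Or.inl (Or.inr rfl))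
  · exact hS _ (Or.inr ⟨(y, i), rfl⟩)
  · refine ⟨_, hhump ?_⟩
    rw [sdiff_eq_empty.2 (inter_subset_left.trans (hAK i))]
    exact finite_empty
  · exact ⟨_, hhump (hB.subset sdiff_subset)⟩

/-- The transfinite recursion along a well-order of the `𝔠` many matrices whose proper initial
segments have fewer than `𝔠` elements. -/
theorem exists_stages (hpc : pseudoIntersectionNumber = continuum) (U : Ultrafilter ℕ)
    (hU : (U : Filter ℕ) ≤ cofinite) :
    ∃ (r : BoundedRows → BoundedRows → Prop) (_ : IsWellOrder BoundedRows r)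
      (F : BoundedRows → Stage U), ∀ x, Serves x (fun y : {y // r y x} => F y) (F x) := by
  obtain ⟨r, hr, hord⟩ := exists_ord_eq BoundedRows
  have hcard : #BoundedRows ≤ continuum := by
    refine (mk_subtype_le _).trans (le_of_eq ?_)
    simp [mk_real]
  have hseg : ∀ x, #{y // r y x} < continuum := fun x =>
    lt_of_lt_of_le (card_typein_lt (r := r) x hord) hcard
  choose G hG using fun (x : BoundedRows) (f : {y // r y x} → Stage U) =>
    exists_serves hpc U hU x (hseg x) f
  have hwf : WellFounded r := hr.wf
  let F : BoundedRows → Stage U := hwf.fix fun x f => G x fun y => f y.1 y.2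
  have hF : ∀ x, F x = G x fun y => F y.1 := fun x => hwf.fix_eq _ x
  refine ⟨r, hr, F, fun x => ?_⟩
  conv => arg 3; rw [hF x]
  exact hG x _

/-! ### Measures given by sequences, and their limits -/

/-- The restriction of an ultrafilter on `ω` to a subalgebra of `P(ω)`. -/
def ultRestrict (𝔅 : BooleanSubalgebra (Set ℕ)) (V : Ultrafilter ℕ) : Ult 𝔅 where
  toPFilter := (Order.IsPFilter.of_def (F := {b : 𝔅 | (b : Set ℕ) ∈ V}) ⟨⊤, V.univ_mem⟩
    (fun a ha b hb => ⟨a ⊓ b, V.inter_mem ha hb, inf_le_left, inf_le_right⟩)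
    (fun {_ _} hab ha => V.mem_of_superset ha hab)).toPFilter
  bot_notMem := V.empty_notMem
  mem_or_compl_mem a := V.em (a : Set ℕ)

theorem mem_ultRestrict {𝔅 : BooleanSubalgebra (Set ℕ)} {V : Ultrafilter ℕ} {b : 𝔅} :
    b ∈ (ultRestrict 𝔅 V).toPFilter ↔ (b : Set ℕ) ∈ V := Iff.rfl

theorem bddAbove_variation {𝔅 : Type*} [BooleanAlgebra 𝔅] (μ : M 𝔅) (a : 𝔅) :
    BddAbove (range fun b : {b : 𝔅 // b ≤ a} => |μ.1 b.1| + |μ.1 (a \ b.1)|) := by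
  obtain ⟨-, C, hC⟩ := μ.2
  refine ⟨C + C, ?_⟩
  rintro _ ⟨b, rfl⟩
  exact add_le_add (hC _) (hC _)

theorem abs_add_abs_compl_le_variationNorm {𝔅 : Type*} [BooleanAlgebra 𝔅] (μ : M 𝔅) (b : 𝔅) :
    |μ.1 b| + |μ.1 bᶜ| ≤ variationNorm μ := by
  rw [← top_sdiff]
  exact le_ciSup (bddAbove_variation μ ⊤) ⟨b, le_top⟩

theorem variationNorm_zero {𝔅 : Type*} [BooleanAlgebra 𝔅] : variationNorm (0 : M 𝔅) = 0 := by
  simp [variationNorm, variation]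

/-- The set of nonnegative weights witnesses that the variation norm dominates the `ℓ₁` norm. -/
theorem tsum_abs_le_variationNorm {μ : M (Set ℕ)} {x : ℕ → ℝ} (hx : Summable x)
    (hμ : ∀ B, μ.1 B = weight x B) : ∑' m, |x m| ≤ variationNorm μ := by
  let b : Set ℕ := {m | 0 ≤ x m}
  have hpt : ∀ m, |x m| = b.indicator x m - bᶜ.indicator x m := fun m => by
    by_cases hm : 0 ≤ x m
    · have h1 : m ∈ b := hm
      simp [h1, abs_of_nonneg hm]
    · have h1 : m ∉ b := hm
      simp [h1, abs_of_neg (not_le.1 hm)]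
  calc ∑' m, |x m| = μ.1 b - μ.1 bᶜ := by
        rw [hμ, hμ, weight_eq, weight_eq, ← (hx.indicator b).tsum_sub (hx.indicator bᶜ)]
        exact tsum_congr hpt
    _ ≤ |μ.1 b| + |μ.1 bᶜ| := (le_abs_self _).trans (abs_sub _ _)
    _ ≤ variationNorm μ := abs_add_abs_compl_le_variationNorm μ b

/-- Uniformly bounded sequences in `M(𝔅)` converge pointwise along ultrafilters. -/
theorem M.exists_tendsto_ultrafilter {𝔅 : Type*} [BooleanAlgebra 𝔅] (V : Ultrafilter ℕ)
    {g : ℕ → 𝔅 → ℝ} {C : ℝ} (hadd : ∀ n a b, Disjoint a b → g n (a ⊔ b) = g n a + g n b)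
    (hg : ∀ n a, |g n a| ≤ C) :
    ∃ ν : M 𝔅, ∀ a, Tendsto (fun n => g n a) V (𝓝 (ν.1 a)) := by
  choose ν hν using fun a => ForkTheorem.exists_tendsto_ultrafilter V fun n => hg n a
  refine ⟨⟨ν, fun a b hab => ?_, C, fun a => ?_⟩, hν⟩
  · refine tendsto_nhds_unique (hν (a ⊔ b)) ?_
    simpa only [hadd _ a b hab] using (hν a).add (hν b)
  · exact le_of_tendsto (hν a).abs (Eventually.of_forall fun n => hg n a)

theorem M.apply_add_sdiff_singleton (μ : M (Set ℕ)) (B : Set ℕ) (n : ℕ) :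
    μ.1 B = μ.1 {n} * B.indicator 1 n + μ.1 (B \ {n}) := by
  by_cases hn : n ∈ B
  · have h := μ.2.1 {n} (B \ {n}) disjoint_sdiff_self_right
    have h' : ({n} : Set ℕ) ⊔ B \ {n} = B := union_sdiff_cancel (singleton_subset_iff.2 hn)
    rw [h'] at h
    simpa [hn] using h
  · simp [hn]

/-- If the generators of the algebra have a common limit along the `A i`, then the limits of the
measures `B ↦ μ_n (B \ {n})` along ultrafilters containing `A 0`, `A 1`, `A 2` coincide on the whole
algebra, while the atoms at `n` converge to multiples of three different point masses. -/
theorem closure_contains_fork {𝒜 : Set (Set ℕ)} {μ : ℕ → M (Set ℕ)} {C : ℝ}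
    (had : IsAlmostDisjoint 𝒜) (hμ : ∀ n B, |(μ n).1 B| ≤ C) {c ε d : ℝ} (hε : 0 ≤ ε)
    (hc : ∀ n, c ≤ |(μ n).1 {n}|) {A : Fin 3 → Set ℕ} (hA : ∀ i, A i ∈ 𝒜)
    (hinf : ∀ i, (A i).Infinite) (hdisj : ∀ i j, i ≠ j → Disjoint (A i) (A j))
    (hd : Tendsto (fun n => (μ n).1 {n}) (cofinite ⊓ 𝓟 (⋃ i, A i)) (𝓝 d))
    (hlim : ∀ B : Set ℕ, B.Finite ∨ B = Set.univ ∨ B ∈ 𝒜 →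
      ∃ ℓ, Tendsto (fun n => (μ n).1 (B \ {n})) (cofinite ⊓ 𝓟 (⋃ i, A i)) (𝓝 ℓ)) :
    ContainsFork c ε (closure (range fun k => restrict (generatedAlgebra 𝒜) (μ k))) := by
  have hV : ∀ i, ∃ V : Ultrafilter ℕ, (V : Filter ℕ) ≤ cofinite ⊓ 𝓟 (A i) := fun i =>
    have := cofinite_inf_principal_neBot_iff.2 (hinf i)
    ⟨Ultrafilter.of _, Ultrafilter.of_le _⟩
  choose V hV using hV
  have hVA : ∀ i, (V i : Filter ℕ) ≤ cofinite ⊓ 𝓟 (⋃ i, A i) := fun i =>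
    (hV i).trans (inf_le_inf_left _ (principal_mono.2 (subset_iUnion A i)))
  have hAV : ∀ i, A i ∈ V i := fun i => le_principal_iff.1 ((hV i).trans inf_le_right)
  have hadd : ∀ n (a b : Set ℕ), Disjoint a b →
      (μ n).1 ((a ⊔ b) \ {n}) = (μ n).1 (a \ {n}) + (μ n).1 (b \ {n}) := fun n a b hab => by
    rw [sup_sdiff]
    exact (μ n).2.1 _ _ (hab.mono sdiff_le sdiff_le)
  choose ν hν using fun i => M.exists_tendsto_ultrafilter (V i)
    (g := fun n (B : Set ℕ) => (μ n).1 (B \ {n})) hadd fun n a => hμ n _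
  have heq : ∀ i j, ∀ B ∈ generatedAlgebra 𝒜, (ν i).1 B = (ν j).1 B := by
    intro i j B hB
    have hgen : ∀ B : Set ℕ, B.Finite ∨ B = Set.univ ∨ B ∈ 𝒜 → (ν i).1 B - (ν j).1 B = 0 := by
      intro B hB
      obtain ⟨ℓ, hℓ⟩ := hlim B hB
      rw [tendsto_nhds_unique (hν i B) (hℓ.mono_left (hVA i)),
        tendsto_nhds_unique (hν j B) (hℓ.mono_left (hVA j)), sub_self]
    have hnull : IsNull 𝒜 fun B => (ν i).1 B - (ν j).1 B :=
      { add := fun a b hab => by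
          have hi := (ν i).2.1 a b hab
          have hj := (ν j).2.1 a b hab
          simp only [sup_eq_union] at hi hj
          rw [hi, hj]
          ring
        finite := fun s hs => hgen s (Or.inl hs)
        mem := fun A hA => hgen A (Or.inr (Or.inr hA))
        univ := hgen Set.univ (Or.inr (Or.inl rfl)) }
    exact sub_eq_zero.1 (hnull.eq_zero had hB)
  refine ⟨fun i => d • dirac (ultRestrict _ (V i)) + restrict _ (ν i), fun i => ?_, d,
    fun i => ultRestrict _ (V i), fun i => restrict _ (ν i), fun i => rfl, ?_, ?_, ?_⟩
  · refine mem_closure_of_tendsto (f := fun n => restrict (generatedAlgebra 𝒜) (μ n))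
      (b := (V i : Filter ℕ)) ?_ (Eventually.of_forall fun n => mem_range_self n)
    rw [tendsto_subtype_rng, tendsto_pi_nhds]
    intro b
    have hind : Tendsto (fun n => (b : Set ℕ).indicator (1 : ℕ → ℝ) n) (V i)
        (𝓝 ((dirac (ultRestrict _ (V i))).1 b)) := by
      refine tendsto_const_nhds.congr' ?_
      by_cases hb : (b : Set ℕ) ∈ V i
      · filter_upwards [hb] with n hn
        simp [dirac, mem_ultRestrict, hb, hn]
      · filter_upwards [Ultrafilter.compl_mem_iff_notMem.2 hb] with n hn
        simp [dirac, mem_ultRestrict, hb, indicator_of_notMem hn]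
    have := ((hd.mono_left (hVA i)).mul hind).add (hν i b)
    exact this.congr fun n => (M.apply_add_sdiff_singleton (μ n) b n).symm
  · exact ge_of_tendsto (hd.mono_left (hVA 0)).abs (Eventually.of_forall hc)
  · intro i j hij
    by_contra hne
    have hmem : A i ∈ generatedAlgebra 𝒜 := BooleanSubalgebra.subset_closure (Or.inl (hA i))
    have hi : (⟨A i, hmem⟩ : generatedAlgebra 𝒜) ∈ (ultRestrict _ (V i)).toPFilter := hAV i
    have hj : A i ∈ V j := by
      simp only at hij
      rwa [hij] at hi
    exact (V j).empty_notMem ((hdisj i j hne).inter_eq ▸ (V j).inter_mem hj (hAV j))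
  · intro i j
    have : restrict (generatedAlgebra 𝒜) (ν i) - restrict _ (ν j) = 0 := by
      rw [sub_eq_zero]
      exact Subtype.ext (funext fun b => heq i j b b.2)
    simpa only [this, variationNorm_zero] using hε

end ForkTheorem

open ForkTheorem in
theorem theorem3p3 (hpc : pseudoIntersectionNumber = Cardinal.continuum) :
    ∃ 𝒜 : Set (Set ℕ), (∀ A ∈ 𝒜, A.Infinite) ∧ IsAlmostDisjoint 𝒜 ∧
      ∀ c : ℝ, 0 < c → c < 1 → ∀ μ : ℕ → M (Set ℕ),
        (∀ n, μ n ∈ Mell1) → (∀ n, variationNorm (μ n) ≤ 1) → (∀ n, c ≤ |(μ n).1 {n}|) →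
        ContainsFork c (c / 2)
          (closure (Set.range fun k => restrict (generatedAlgebra 𝒜) (μ k))) := by
  obtain ⟨r, hr, F, hF⟩ := exists_stages hpc (Filter.hyperfilter ℕ)
    Filter.hyperfilter_le_cofinite
  have hlater : ∀ x y i j, r y x → ((F x).A i ∩ (F y).A j).Finite := fun x y i j hyx =>
    ((hF x).finite_inter ⟨y, hyx⟩ i).subset (Set.inter_subset_inter_right _ ((F y).subset j))
  have had : IsAlmostDisjoint (Set.range fun q : BoundedRows × Fin 3 => (F q.1).A q.2) := by
    rintro _ ⟨⟨x, i⟩, rfl⟩ _ ⟨⟨y, j⟩, rfl⟩ hne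
    rcases trichotomous_of r x y with hxy | rfl | hyx
    · rw [Set.inter_comm]
      exact hlater y x j i hxy
    · rw [((F x).disjoint i j fun h => hne (by rw [h])).inter_eq]
      exact Set.finite_empty
    · exact hlater x y i j hyx
  refine ⟨_, ?_, had, fun c hc0 _ μ hμ hnorm hc => ?_⟩
  · rintro _ ⟨q, rfl⟩
    exact (F q.1).infinite q.2
  choose x hx using hμ
  have hsum : ∀ n, Summable (x n) := fun n => by
    refine Summable.of_abs ?_
    simpa using (lp.memℓp (x n)).summable (by norm_num)
  have hweight : ∀ n B, (μ n).1 B = weight (x n) B := hx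
  have hle : ∀ n, ∑' m, |x n m| ≤ 1 := fun n =>
    (tsum_abs_le_variationNorm (hsum n) (hweight n)).trans (hnorm n)
  let X : BoundedRows := ⟨fun n m => x n m, 1, fun n => ⟨hsum n, hle n⟩⟩
  obtain ⟨d, hd⟩ := (hF X).tendsto_diag
  refine closure_contains_fork had (C := 1) (fun n B => ?_) (half_pos hc0).le hc
    (A := (F X).A) (fun i => ⟨(X, i), rfl⟩) (F X).infinite (F X).disjoint (d := d) ?_ ?_
  · rw [hweight]
    exact (abs_weight_le (hsum n) B).trans (hle n)
  · simpa only [hweight, weight_singleton] using hd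
  · simp only [hweight]
    rintro B (hB | hB | ⟨⟨y, i⟩, rfl⟩)
    · exact (hF X).tendsto B (Or.inl hB)
    · exact (hF X).tendsto B (Or.inr (Or.inl hB))
    · refine (hF X).tendsto _ ?_
      rcases trichotomous_of r y X with hyX | rfl | hXy
      · exact Or.inr (Or.inr (Or.inl ⟨⟨y, hyX⟩, i, rfl⟩))
      · exact Or.inr (Or.inr (Or.inr (Or.inl ⟨i, rfl⟩)))
      · exact Or.inr (Or.inr (Or.inr (Or.inr ((hF y).finite_inter ⟨X, hXy⟩ i))))
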